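/- Let $m_1,m_2\ge 0$ be integers with $m=m_1+m_2>0$, let $p\le m$, let $n\ge 1$, let $r\ge0$ be an integer, let $j=\mathrm{diag}\{I_{m_1},-I_{m_2}\}$, and let $\mathcal I\subset\mathbb R$ be an interval with $0\in\mathcal I$. Let $c_1,\dots,c_r\in\mathbb R$, and let $\beta_k:\mathcal I\to\mathbb C^{p\times m}$ $(1\le k\le r)$ be such that the Hamiltonians $H_k=\beta_k^*\beta_k$ are locally summable on $\mathcal I$. Let $A,S(0)\in\mathbb C^{n\times n}$ and $\Pi(0)\in\mathbb C^{n\times m}$ satisfy $$c_k\notin\sigma(A)\ (1\le k\le r),\qquad AS(0)-S(0)A^*=\mathrm i\,\Pi(0)j\Pi(0)^*,\qquad S(0)=S(0)^*.$$ Let $\Pi:\mathcal I\to\mathbb C^{n\times m}$ and $S:\mathcal I\to\mathbb C^{n\times n}$ be locally absolutely continuous functions with these values at $0$ which satisfy, almost everywhere on $\mathcal I$, $$\Pi'(x)=-\mathrm i\sum_{k=1}^r(A-c_kI_n)^{-1}\Pi(x)jH_k(x),\tag{1}$$ $$S'(x)=-\sum_{k=1}^r(A-c_kI_n)^{-1}\Pi(x)jH_k(x)j\Pi(x)^*(A^*-c_kI_n)^{-1}.\tag{2}$$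 At the points of $\mathcal I$ where $S(x)$ is invertible, put, for $z\notin\sigma(A)$, $$w_A(x,z)=I_m-\mathrm i\,j\Pi(x)^*S(x)^{-1}(A-zI_n)^{-1}\Pi(x),\qquad \widetilde\beta_k(x)=\beta_k(x)\,j\,w_A(x,c_k)^*j,\qquad \widetilde H_k(x)=\widetilde\beta_k(x)^*\widetilde\beta_k(x),$$ and, for $\zeta=(\zeta_1,\dots,\zeta_r)\in\mathbb C^r$, define the $m\times n$ matrix function $$\widetilde\psi(x,\zeta_1,\dots,\zeta_r)=j\Pi(x)^*S(x)^{-1}\exp\Big\{\sum_{k=1}^r\zeta_k(A-c_kI_n)^{-1}\Big\}.$$ Then, for every $\zeta$, the function $x\mapsto\widetilde\psi(x,\zeta)$ is absolutely continuous on every compact interval contained in $\{x\in\mathcal I:\ S(x)\text{ is invertible}\}$. Moreover, for almost every $x\in\mathcal I$ at which $S(x)$ is invertible, all the partial derivatives below exist for all $\zeta\in\mathbb C^r$, and $$\frac{\partial\widetilde\psi}{\partial x}=\mathrm i\sum_{k=1}^r j\widetilde H_k(x)\frac{\partial\widetilde\psi}{\partial\zeta_k}\qquad\text{for all }\zeta\in\mathbb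 C^r.\tag{3}$$ More precisely, this holds at every $x\in\mathcal I$ at which $S(x)$ is invertible and $\Pi$ and $S$ have derivatives satisfying (1) and (2) (derivatives in $x$ being one-sided at an end point of $\mathcal I$). -/

import Mathlib

open Matrix MeasureTheory

namespace GBDT

noncomputable section

/-- Entrywise derivative of a matrix function of a real or complex variable within a set. -/
def HasMatDerivWithinAt {𝕜 : Type} [NontriviallyNormedField 𝕜] [NormedAlgebra 𝕜 ℂ]
    {a b : Type} (F : 𝕜 → Matrix a b ℂ) (F' : Matrix a b ℂ) (s : Set 𝕜) (x : 𝕜) : Prop :=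
  ∀ i j, HasDerivWithinAt (fun t => F t i j) (F' i j) s x

/-- Absolute continuity (entrywise) of a matrix function on every compact interval contained
in the set `D`. -/
def LocallyAbsContOn {a b : Type} (F : ℝ → Matrix a b ℂ) (D : Set ℝ) : Prop :=
  ∀ s t : ℝ, Set.uIcc s t ⊆ D →
    ∀ i j, AbsolutelyContinuousOnInterval (fun x => F x i j) s t

/-- `F' = V` on the interval `I` in the Carathéodory sense: `F` is locally absolutely continuous
on `I`, and the equation holds at almost every point of `I`. -/
def SolvesODEOn {a b : Type} (F V : ℝ → Matrix a b ℂ) (I : Set ℝ) : Prop :=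
  LocallyAbsContOn F I ∧ ∀ᵐ x : ℝ, x ∈ I → HasMatDerivWithinAt F (V x) I x

/-- The signature matrix `diag(I_{m₁}, -I_{m₂})`. -/
def sigMat (m₁ m₂ : ℕ) : Matrix (Fin m₁ ⊕ Fin m₂) (Fin m₁ ⊕ Fin m₂) ℂ :=
  Matrix.fromBlocks 1 0 0 (-1)

/-- The inverse `(A - z I_n)⁻¹`. -/
def resolv {n : ℕ} (A : Matrix (Fin n) (Fin n) ℂ) (z : ℂ) : Matrix (Fin n) (Fin n) ℂ :=
  (A - z • (1 : Matrix (Fin n) (Fin n) ℂ))⁻¹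

variable {m₁ m₂ p n r : ℕ}

/-- The Hamiltonians `H_k = β_k^* β_k`. -/
def ham (β : Fin r → ℝ → Matrix (Fin p) (Fin m₁ ⊕ Fin m₂) ℂ) (k : Fin r) (x : ℝ) :
    Matrix (Fin m₁ ⊕ Fin m₂) (Fin m₁ ⊕ Fin m₂) ℂ :=
  (β k x)ᴴ * β k x

/-- The right-hand side `-i ∑ (A - c_k)⁻¹ Π j H_k` of the equation for `Π'`. -/
def rhsPi (A : Matrix (Fin n) (Fin n) ℂ) (c : Fin r → ℝ)
    (β : Fin r → ℝ → Matrix (Fin p) (Fin m₁ ⊕ Fin m₂) ℂ)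
    (P : ℝ → Matrix (Fin n) (Fin m₁ ⊕ Fin m₂) ℂ) (x : ℝ) :
    Matrix (Fin n) (Fin m₁ ⊕ Fin m₂) ℂ :=
  -(Complex.I • ∑ k, resolv A (c k) * P x * sigMat m₁ m₂ * ham β k x)

/-- The right-hand side `-∑ (A - c_k)⁻¹ Π j H_k j Π^* (A^* - c_k)⁻¹` of the equation for `S'`. -/
def rhsS (A : Matrix (Fin n) (Fin n) ℂ) (c : Fin r → ℝ)
    (β : Fin r → ℝ → Matrix (Fin p) (Fin m₁ ⊕ Fin m₂) ℂ)
    (P : ℝ → Matrix (Fin n) (Fin m₁ ⊕ Fin m₂) ℂ) (x : ℝ) : Matrix (Fin n) (Fin n) ℂ :=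
  -∑ k, resolv A (c k) * P x * sigMat m₁ m₂ * ham β k x * sigMat m₁ m₂ * (P x)ᴴ *
    resolv Aᴴ (c k)

/-- The transfer matrix function `w_A(x, z) = I_m - i j Π(x)^* S(x)⁻¹ (A - z I_n)⁻¹ Π(x)`. -/
def transfer (A : Matrix (Fin n) (Fin n) ℂ)
    (P : ℝ → Matrix (Fin n) (Fin m₁ ⊕ Fin m₂) ℂ) (S : ℝ → Matrix (Fin n) (Fin n) ℂ)
    (x : ℝ) (z : ℂ) : Matrix (Fin m₁ ⊕ Fin m₂) (Fin m₁ ⊕ Fin m₂) ℂ :=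
  1 - Complex.I • (sigMat m₁ m₂ * (P x)ᴴ * (S x)⁻¹ * resolv A z * P x)

/-- `β̃_k(x) = β_k(x) j w_A(x, c_k)^* j`. -/
def transBeta (A : Matrix (Fin n) (Fin n) ℂ) (c : Fin r → ℝ)
    (β : Fin r → ℝ → Matrix (Fin p) (Fin m₁ ⊕ Fin m₂) ℂ)
    (P : ℝ → Matrix (Fin n) (Fin m₁ ⊕ Fin m₂) ℂ) (S : ℝ → Matrix (Fin n) (Fin n) ℂ)
    (k : Fin r) (x : ℝ) : Matrix (Fin p) (Fin m₁ ⊕ Fin m₂) ℂ :=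
  β k x * sigMat m₁ m₂ * (transfer A P S x (c k))ᴴ * sigMat m₁ m₂

/-- `ψ̃(x, ζ) = j Π(x)^* S(x)⁻¹ exp(∑ ζ_k (A - c_k I_n)⁻¹)`. -/
def psiTilde (A : Matrix (Fin n) (Fin n) ℂ) (c : Fin r → ℝ)
    (P : ℝ → Matrix (Fin n) (Fin m₁ ⊕ Fin m₂) ℂ) (S : ℝ → Matrix (Fin n) (Fin n) ℂ)
    (x : ℝ) (ζ : Fin r → ℂ) : Matrix (Fin m₁ ⊕ Fin m₂) (Fin n) ℂ :=
  sigMat m₁ m₂ * (P x)ᴴ * (S x)⁻¹ * NormedSpace.exp (∑ k, ζ k • resolv A (c k))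

/-- At the point `x` of the interval `I`, and for every `ζ`, all partial derivatives of `ψ` exist
and `∂ψ/∂x = i ∑ j K_k(x) ∂ψ/∂ζ_k`. Here `D k` is `∂ψ/∂ζ_k`; the `x`-derivative is taken
within `I`, so it is one-sided at an end point of `I`. -/
def DynSystemAt (K : Fin r → ℝ → Matrix (Fin m₁ ⊕ Fin m₂) (Fin m₁ ⊕ Fin m₂) ℂ)
    (ψ : ℝ → (Fin r → ℂ) → Matrix (Fin m₁ ⊕ Fin m₂) (Fin n) ℂ) (I : Set ℝ) (x : ℝ) : Prop :=
  ∀ ζ : Fin r → ℂ, ∃ D : Fin r → Matrix (Fin m₁ ⊕ Fin m₂) (Fin n) ℂ,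
    (∀ k, HasMatDerivWithinAt (fun s : ℂ => ψ x (Function.update ζ k s)) (D k) Set.univ (ζ k)) ∧
    HasMatDerivWithinAt (fun t : ℝ => ψ t ζ)
      (Complex.I • ∑ k, sigMat m₁ m₂ * K k x * D k) I x

end

end GBDT

/-!
Write `R_k = (A - c_k)⁻¹`. Equations (1) and (2) propagate the identities `S = S^*` and
`A S - S A^* = i Π j Π^*` from a single point to the whole interval, since both sides of each
identity solve the same equation. Multiplying the second identity by the resolvents and `S⁻¹`
from both sides turns it into the intertwining relation
`w_A(x, c_k)^* Π^* S⁻¹ R_k = Π^* R_k^* S⁻¹`. The product rule gives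
`(j Π^* S⁻¹)' = i ∑ w_A(x, c_k) j H_k j Π^* R_k^* S⁻¹`, which by the intertwining relation is
`i ∑ j H̃_k (j Π^* S⁻¹) R_k`. Multiplication by `exp (∑ ζ_k R_k)` on the right then replaces each
factor `R_k` by `∂/∂ζ_k`, because the `R_k` commute.
-/

namespace GBDT

open Filter Topology
open scoped NNReal

section AbsolutelyContinuous

variable {X Y E : Type*} [PseudoMetricSpace X] [PseudoMetricSpace Y] [SeminormedAddCommGroup E]
  {s t : ℝ}

theorem absolutelyContinuousOnInterval_const (z : X) :
    AbsolutelyContinuousOnInterval (fun _ => z) s t :=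
  (LipschitzWith.const (α := ℝ) z).lipschitzOnWith.absolutelyContinuousOnInterval

theorem absolutelyContinuousOnInterval_lipschitzOnWith_comp {f : ℝ → X} {g : X → Y} {K : ℝ≥0}
    (hg : LipschitzOnWith K g (f '' Set.uIcc s t)) (hf : AbsolutelyContinuousOnInterval f s t) :
    AbsolutelyContinuousOnInterval (fun x => g (f x)) s t := by
  refine squeeze_zero' (g := fun E => (K : ℝ) * ∑ i ∈ Finset.range E.1,
    dist (f (E.2 i).1) (f (E.2 i).2)) (.of_forall fun E => Finset.sum_nonneg fun _ _ => dist_nonneg)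
    ?_ (by simpa only [mul_zero] using Tendsto.const_mul (K : ℝ) hf)
  filter_upwards [mem_inf_of_right (mem_principal_self _)] with E hE
  rw [Finset.mul_sum]
  exact Finset.sum_le_sum fun i hi => hg.dist_le_mul _ (Set.mem_image_of_mem f (hE.1 i hi).1) _
    (Set.mem_image_of_mem f (hE.1 i hi).2)

theorem absolutelyContinuousOnInterval_finsetSum {ι : Type*} (u : Finset ι) {f : ι → ℝ → E}
    (hf : ∀ i ∈ u, AbsolutelyContinuousOnInterval (f i) s t) :
    AbsolutelyContinuousOnInterval (fun x => ∑ i ∈ u, f i x) s t := by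
  classical
  induction u using Finset.induction_on with
  | empty => simpa only [Finset.sum_empty] using absolutelyContinuousOnInterval_const (0 : E)
  | insert i u hi ih =>
    simp only [Finset.sum_insert hi]
    exact (hf i (Finset.mem_insert_self i u)).fun_add
      (ih fun j hj => hf j (Finset.mem_insert_of_mem hj))

theorem lipschitzOnWith_ringInverse {R : Type*} [SeminormedRing R] {U : Set R} {C : ℝ≥0}
    (hU : ∀ a ∈ U, IsUnit a) (hC : ∀ a ∈ U, ‖Ring.inverse a‖ ≤ C) :
    LipschitzOnWith (C * C) Ring.inverse U := by
  refine LipschitzOnWith.of_dist_le_mul fun a ha b hb => ?_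
  rw [dist_eq_norm, dist_comm, dist_eq_norm,
    Ring.inverse_sub_inverse (iff_of_true (hU a ha) (hU b hb))]
  calc ‖Ring.inverse a * (b - a) * Ring.inverse b‖
      ≤ ‖Ring.inverse a‖ * ‖b - a‖ * ‖Ring.inverse b‖ := norm_mul₃_le
    _ ≤ C * ‖b - a‖ * C := by gcongr <;> exact hC _ ‹_›
    _ = ↑(C * C) * ‖b - a‖ := by push_cast; ring

theorem absolutelyContinuousOnInterval_ringInverse {R : Type*} [NormedRing R]
    [HasSummableGeomSeries R] {f : ℝ → R} (hf : AbsolutelyContinuousOnInterval f s t)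
    (hu : ∀ x ∈ Set.uIcc s t, IsUnit (f x)) :
    AbsolutelyContinuousOnInterval (fun x => Ring.inverse (f x)) s t := by
  have hcont : ContinuousOn (fun x => Ring.inverse (f x)) (Set.uIcc s t) := fun x hx => by
    obtain ⟨u, hux⟩ := hu x hx
    have := NormedRing.inverse_continuousAt u
    rw [hux] at this
    exact this.comp_continuousWithinAt (hf.continuousOn x hx)
  obtain ⟨C, hC⟩ := isCompact_uIcc.exists_bound_of_continuousOn hcont
  refine absolutelyContinuousOnInterval_lipschitzOnWith_comp (lipschitzOnWith_ringInverse
    (Set.forall_mem_image.2 hu) (C := C.toNNReal) (Set.forall_mem_image.2 fun x hx => ?_)) hf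
  exact (hC x hx).trans (Real.le_coe_toNNReal C)

end AbsolutelyContinuous

open scoped Matrix.Norms.Operator in
theorem locallyAbsContOn_iff {a b : Type} [Fintype a] [Fintype b] {F : ℝ → Matrix a b ℂ}
    {D : Set ℝ} : LocallyAbsContOn F D ↔
      ∀ s t, Set.uIcc s t ⊆ D → AbsolutelyContinuousOnInterval F s t := by
  classical
  refine ⟨fun hF s t hst => ?_, fun hF s t hst i j => ?_⟩
  · have hsum : F = fun x => ∑ i, ∑ j, F x i j • Matrix.single i j (1 : ℂ) :=
      funext fun x => by
        simpa only [Matrix.smul_single, smul_eq_mul, mul_one] using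
          Matrix.matrix_eq_sum_single (F x)
    rw [hsum]
    exact absolutelyContinuousOnInterval_finsetSum _ fun i _ =>
      absolutelyContinuousOnInterval_finsetSum _ fun j _ =>
        (hF s t hst i j).smul (absolutelyContinuousOnInterval_const _)
  · exact absolutelyContinuousOnInterval_lipschitzOnWith_comp
      (Matrix.entryLinearMap ℂ ℂ i j).toContinuousLinearMap.lipschitz.lipschitzOnWith (hF s t hst)

namespace LocallyAbsContOn

variable {a b d : Type} {D : Set ℝ}

theorem mono {F : ℝ → Matrix a b ℂ} {D' : Set ℝ} (hF : LocallyAbsContOn F D) (h : D' ⊆ D) :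
    LocallyAbsContOn F D' :=
  fun s t hst => hF s t (hst.trans h)

theorem const (M : Matrix a b ℂ) : LocallyAbsContOn (fun _ => M) D :=
  fun _ _ _ i j => absolutelyContinuousOnInterval_const (M i j)

theorem sub {F G : ℝ → Matrix a b ℂ} (hF : LocallyAbsContOn F D) (hG : LocallyAbsContOn G D) :
    LocallyAbsContOn (fun x => F x - G x) D :=
  fun s t hst i j => (hF s t hst i j).fun_sub (hG s t hst i j)

theorem const_smul {F : ℝ → Matrix a b ℂ} (z : ℂ) (hF : LocallyAbsContOn F D) :
    LocallyAbsContOn (fun x => z • F x) D :=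
  fun s t hst i j => (hF s t hst i j).const_smul z

theorem mul [Fintype b] {F : ℝ → Matrix a b ℂ} {G : ℝ → Matrix b d ℂ}
    (hF : LocallyAbsContOn F D) (hG : LocallyAbsContOn G D) :
    LocallyAbsContOn (fun x => F x * G x) D := by
  intro s t hst i j
  simp only [Matrix.mul_apply]
  exact absolutelyContinuousOnInterval_finsetSum _ fun k _ => (hF s t hst i k).smul (hG s t hst k j)

theorem conjTranspose {F : ℝ → Matrix a b ℂ} (hF : LocallyAbsContOn F D) :
    LocallyAbsContOn (fun x => (F x)ᴴ) D :=
  fun s t hst i j => absolutelyContinuousOnInterval_lipschitzOnWith_comp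
    (starₗᵢ ℂ (E := ℂ)).lipschitz.lipschitzOnWith (hF s t hst j i)

open scoped Matrix.Norms.Operator in
theorem inv [Fintype a] [DecidableEq a] {F : ℝ → Matrix a a ℂ}
    (hF : LocallyAbsContOn F D) (h : ∀ x ∈ D, IsUnit (F x)) :
    LocallyAbsContOn (fun x => (F x)⁻¹) D := by
  rw [locallyAbsContOn_iff] at hF ⊢
  intro s t hst
  simp only [Matrix.nonsing_inv_eq_ringInverse]
  exact absolutelyContinuousOnInterval_ringInverse (hF s t hst) fun x hx => h x (hst hx)

end LocallyAbsContOn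

theorem hasMatDerivWithinAt_iff {𝕜 : Type} [NontriviallyNormedField 𝕜] [NormedAlgebra 𝕜 ℂ]
    {a b : Type} [Finite a] [Finite b] {F : 𝕜 → Matrix a b ℂ} {F' : Matrix a b ℂ} {s : Set 𝕜}
    {x : 𝕜} : HasMatDerivWithinAt F F' s x ↔ HasDerivWithinAt F F' s x := by
  cases nonempty_fintype a
  cases nonempty_fintype b
  exact ⟨fun h => hasDerivWithinAt_pi.2 fun i => hasDerivWithinAt_pi.2 (h i),
    fun h i => hasDerivWithinAt_pi.1 (hasDerivWithinAt_pi.1 h i)⟩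

namespace HasMatDerivWithinAt

variable {𝕜 : Type} [NontriviallyNormedField 𝕜] [NormedAlgebra 𝕜 ℂ] {a b d : Type}
  {F : 𝕜 → Matrix a b ℂ} {F' : Matrix a b ℂ} {s : Set 𝕜} {x : 𝕜}

theorem const (M : Matrix a b ℂ) : HasMatDerivWithinAt (fun _ => M) 0 s x :=
  fun i j => hasDerivWithinAt_const x s (M i j)

theorem sub {G : 𝕜 → Matrix a b ℂ} {G' : Matrix a b ℂ}
    (hF : HasMatDerivWithinAt F F' s x) (hG : HasMatDerivWithinAt G G' s x) :
    HasMatDerivWithinAt (fun t => F t - G t) (F' - G') s x :=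
  fun i j => (hF i j).fun_sub (hG i j)

theorem const_smul (z : ℂ) (hF : HasMatDerivWithinAt F F' s x) :
    HasMatDerivWithinAt (fun t => z • F t) (z • F') s x :=
  fun i j => (hF i j).const_mul z

theorem mul [Fintype b] {G : 𝕜 → Matrix b d ℂ} {G' : Matrix b d ℂ}
    (hF : HasMatDerivWithinAt F F' s x) (hG : HasMatDerivWithinAt G G' s x) :
    HasMatDerivWithinAt (fun t => F t * G t) (F' * G x + F x * G') s x := by
  intro i j
  simp only [Matrix.add_apply, Matrix.mul_apply, ← Finset.sum_add_distrib]
  exact HasDerivWithinAt.fun_sum fun k _ => (hF i k).fun_mul (hG k j)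

theorem const_mul [Fintype a] (M : Matrix d a ℂ) (hF : HasMatDerivWithinAt F F' s x) :
    HasMatDerivWithinAt (fun t => M * F t) (M * F') s x := by
  simpa only [Matrix.zero_mul, zero_add] using (const M).mul hF

theorem mul_const [Fintype b] (hF : HasMatDerivWithinAt F F' s x) (M : Matrix b d ℂ) :
    HasMatDerivWithinAt (fun t => F t * M) (F' * M) s x := by
  simpa only [Matrix.mul_zero, add_zero] using hF.mul (const M)

theorem conjTranspose {F : ℝ → Matrix a b ℂ} {s : Set ℝ} {x : ℝ}
    (hF : HasMatDerivWithinAt F F' s x) : HasMatDerivWithinAt (fun t => (F t)ᴴ) F'ᴴ s x :=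
  fun i j => (hF j i).star

open scoped Matrix.Norms.Operator in
theorem inv [Fintype a] [DecidableEq a] {F : 𝕜 → Matrix a a ℂ} {F' : Matrix a a ℂ}
    (hF : HasMatDerivWithinAt F F' s x) (h : IsUnit (F x)) :
    HasMatDerivWithinAt (fun t => (F t)⁻¹) (-((F x)⁻¹ * F' * (F x)⁻¹)) s x := by
  rw [hasMatDerivWithinAt_iff] at hF ⊢
  obtain ⟨u, hu⟩ := h
  have hinv := hasFDerivAt_ringInverse (𝕜 := 𝕜) u
  rw [hu] at hinv
  simp only [Matrix.nonsing_inv_eq_ringInverse]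
  have hux : Ring.inverse (F x) = ↑u⁻¹ := by rw [← hu, Ring.inverse_unit]
  rw [hux]
  exact hinv.comp_hasDerivWithinAt x hF

end HasMatDerivWithinAt

theorem uIcc_mem_nhds_of_ne {x y t : ℝ} (ht : t ∈ Set.uIcc x y) (hx : t ≠ x) (hy : t ≠ y) :
    Set.uIcc x y ∈ 𝓝 t := by
  refine Icc_mem_nhds (lt_of_le_of_ne ht.1 ?_) (lt_of_le_of_ne ht.2 ?_) <;> grind

theorem SolvesODEOn.eqOn {a b : Type} {F G V : ℝ → Matrix a b ℂ} {I : Set ℝ} {x₀ : ℝ}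
    (hI : I.OrdConnected) (hF : SolvesODEOn F V I) (hG : SolvesODEOn G V I) (hx₀ : x₀ ∈ I)
    (h₀ : F x₀ = G x₀) : Set.EqOn F G I := by
  intro x hx
  have hsub : Set.uIcc x₀ x ⊆ I := hI.uIcc_subset hx₀ hx
  ext i j
  obtain ⟨C, hC⟩ :=
    ((hF.1.sub hG.1) x₀ x hsub i j).const_of_ae_hasDerivAt_zero (by
      filter_upwards [hF.2, hG.2, Measure.ae_ne volume x₀, Measure.ae_ne volume x]
        with t hFt hGt ht₀ htx ht
      have hd := ((hFt (hsub ht)).sub (hGt (hsub ht))) i j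
      rw [sub_self] at hd
      exact hd.hasDerivAt (mem_of_superset (uIcc_mem_nhds_of_ne ht ht₀ htx) hsub))
  have hdiff : F x i j - G x i j = F x₀ i j - G x₀ i j :=
    (hC x Set.right_mem_uIcc).trans (hC x₀ Set.left_mem_uIcc).symm
  rwa [h₀, sub_self, sub_eq_zero] at hdiff

theorem hasDerivAt_exp_sum_update_smul {ι 𝔸 : Type*} [Fintype ι] [DecidableEq ι] [NormedRing 𝔸]
    [NormedAlgebra ℂ 𝔸] [CompleteSpace 𝔸] {R : ι → 𝔸} {k : ι} (hR : ∀ l, Commute (R l) (R k))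
    (ζ : ι → ℂ) :
    HasDerivAt (fun s => NormedSpace.exp (∑ l, Function.update ζ k s l • R l))
      (R k * NormedSpace.exp (∑ l, ζ l • R l)) (ζ k) := by
  let _ : NormedAlgebra ℚ 𝔸 := .restrictScalars ℚ ℂ 𝔸
  set B := ∑ l ∈ Finset.univ.erase k, ζ l • R l with hB
  have hcomm : Commute B (R k) := Commute.sum_left _ _ _ fun l _ => (hR l).smul_left _
  have hsum : ∀ s : ℂ, ∑ l, Function.update ζ k s l • R l = B + s • R k := by
    intro s
    rw [← Finset.sum_erase_add _ _ (Finset.mem_univ k), Function.update_self, hB]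
    congr 1
    exact Finset.sum_congr rfl fun l hl => by
      rw [Function.update_of_ne (Finset.ne_of_mem_erase hl)]
  have hexp : ∀ s : ℂ, NormedSpace.exp (∑ l, Function.update ζ k s l • R l) =
      NormedSpace.exp B * NormedSpace.exp (s • R k) := fun s => by
    rw [hsum, NormedSpace.exp_add_of_commute (hcomm.smul_right s)]
  have hζ := hexp (ζ k)
  rw [Function.update_eq_self] at hζ
  rw [hζ, ← mul_assoc, (hcomm.exp_left).symm.eq, mul_assoc]
  simp only [hexp]
  exact (hasDerivAt_exp_smul_const' (R k) (ζ k)).const_mul _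

section Resolvent

variable {n : ℕ} {A B : Matrix (Fin n) (Fin n) ℂ} {z : ℂ}

theorem resolv_commute (A : Matrix (Fin n) (Fin n) ℂ) (z w : ℂ) :
    Commute (resolv A z) (resolv A w) := by
  simp only [resolv, Matrix.nonsing_inv_eq_ringInverse]
  exact (((Commute.refl A).sub_right ((Commute.one_right A).smul_right w)).sub_left
    ((Commute.one_left _).smul_left z)).ringInverse_ringInverse

theorem isUnit_sub_smul_one (hz : z ∉ spectrum ℂ A) :
    IsUnit (A - z • (1 : Matrix (Fin n) (Fin n) ℂ)) := by
  simpa only [Algebra.algebraMap_eq_smul_one, neg_sub] using (spectrum.notMem_iff.1 hz).neg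

theorem mul_resolv (hz : z ∉ spectrum ℂ A) : A * resolv A z = 1 + z • resolv A z := by
  have hinv := Matrix.mul_nonsing_inv _
    ((Matrix.isUnit_iff_isUnit_det _).1 (isUnit_sub_smul_one hz))
  rwa [← resolv, Matrix.sub_mul, Matrix.smul_mul, Matrix.one_mul, sub_eq_iff_eq_add] at hinv

theorem resolv_mul (hz : z ∉ spectrum ℂ A) : resolv A z * A = 1 + z • resolv A z := by
  have hinv := Matrix.nonsing_inv_mul _
    ((Matrix.isUnit_iff_isUnit_det _).1 (isUnit_sub_smul_one hz))
  rwa [← resolv, Matrix.mul_sub, Matrix.mul_smul, Matrix.mul_one, sub_eq_iff_eq_add] at hinv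

theorem conjTranspose_resolv (A : Matrix (Fin n) (Fin n) ℂ) (z : ℂ) :
    (resolv A z)ᴴ = resolv Aᴴ (star z) := by
  simp only [resolv, Matrix.conjTranspose_nonsing_inv, Matrix.conjTranspose_sub,
    Matrix.conjTranspose_smul, Matrix.conjTranspose_one]

theorem ofReal_notMem_spectrum_conjTranspose {c : ℝ} (hc : (c : ℂ) ∉ spectrum ℂ A) :
    (c : ℂ) ∉ spectrum ℂ Aᴴ := by
  rw [← Matrix.star_eq_conjTranspose, spectrum.map_star]
  simpa using hc

theorem sylvester_resolv_mul_resolv (hA : z ∉ spectrum ℂ A) (hB : z ∉ spectrum ℂ B)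
    (M : Matrix (Fin n) (Fin n) ℂ) :
    A * (resolv A z * M * resolv B z) - resolv A z * M * resolv B z * B =
      M * resolv B z - resolv A z * M := by
  calc A * (resolv A z * M * resolv B z) - resolv A z * M * resolv B z * B
      = A * resolv A z * M * resolv B z - resolv A z * M * (resolv B z * B) := by noncomm_ring
    _ = M * resolv B z - resolv A z * M := by
      rw [mul_resolv hA, resolv_mul hB]
      noncomm_ring

theorem resolv_mul_inv_mul_sylvester_mul_inv_mul_resolv (hA : z ∉ spectrum ℂ A)
    (hB : z ∉ spectrum ℂ B) {S : Matrix (Fin n) (Fin n) ℂ} (hS : IsUnit S) :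
    resolv B z * S⁻¹ * (A * S - S * B) * S⁻¹ * resolv A z =
      resolv B z * S⁻¹ - S⁻¹ * resolv A z := by
  have hdet := (Matrix.isUnit_iff_isUnit_det _).1 hS
  calc resolv B z * S⁻¹ * (A * S - S * B) * S⁻¹ * resolv A z
      = resolv B z * S⁻¹ * A * (S * S⁻¹) * resolv A z -
          resolv B z * (S⁻¹ * S) * B * S⁻¹ * resolv A z := by noncomm_ring
    _ = resolv B z * S⁻¹ * (A * resolv A z) - resolv B z * B * S⁻¹ * resolv A z := by
      rw [Matrix.mul_nonsing_inv _ hdet, Matrix.nonsing_inv_mul _ hdet]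
      noncomm_ring
    _ = resolv B z * S⁻¹ - S⁻¹ * resolv A z := by
      rw [mul_resolv hA, resolv_mul hB]
      noncomm_ring

end Resolvent

section SymmetricNode

variable {m₁ m₂ n : ℕ}

theorem sigMat_mul_self : sigMat m₁ m₂ * sigMat m₁ m₂ = 1 := by
  simp [sigMat, Matrix.fromBlocks_multiply]

theorem conjTranspose_sigMat : (sigMat m₁ m₂)ᴴ = sigMat m₁ m₂ := by
  simp [sigMat, Matrix.fromBlocks_conjTranspose]

/-- The triple `{A, S, Q}` is a symmetric S-node: `S` is selfadjoint and satisfies the matrix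
(operator) identity `A S - S A^* = i Q j Q^*`, where `j = diag(I_{m₁}, -I_{m₂})`. -/
structure IsSymmetricSNode (A S : Matrix (Fin n) (Fin n) ℂ)
    (Q : Matrix (Fin n) (Fin m₁ ⊕ Fin m₂) ℂ) : Prop where
  isHermitian : S.IsHermitian
  identity : A * S - S * Aᴴ = Complex.I • (Q * sigMat m₁ m₂ * Qᴴ)

variable {A : Matrix (Fin n) (Fin n) ℂ} {P : ℝ → Matrix (Fin n) (Fin m₁ ⊕ Fin m₂) ℂ}
  {S : ℝ → Matrix (Fin n) (Fin n) ℂ} {x : ℝ}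

theorem conjTranspose_transfer (hS : (S x).IsHermitian) (z : ℂ) :
    (transfer A P S x z)ᴴ =
      1 + Complex.I • ((P x)ᴴ * resolv Aᴴ (star z) * (S x)⁻¹ * P x * sigMat m₁ m₂) := by
  simp [transfer, Matrix.conjTranspose_mul, conjTranspose_sigMat, conjTranspose_resolv,
    Matrix.conjTranspose_nonsing_inv, hS.eq, Matrix.mul_assoc]

theorem IsSymmetricSNode.conjTranspose_transfer_mul (h : IsSymmetricSNode A (S x) (P x)) {c : ℝ}
    (hc : (c : ℂ) ∉ spectrum ℂ A) (hSx : IsUnit (S x)) :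
    (transfer A P S x c)ᴴ * (P x)ᴴ * (S x)⁻¹ * resolv A c =
      (P x)ᴴ * resolv Aᴴ c * (S x)⁻¹ := by
  have hnode := resolv_mul_inv_mul_sylvester_mul_inv_mul_resolv hc
    (ofReal_notMem_spectrum_conjTranspose hc) hSx
  rw [h.identity] at hnode
  calc (transfer A P S x c)ᴴ * (P x)ᴴ * (S x)⁻¹ * resolv A c
      = (P x)ᴴ * ((S x)⁻¹ * resolv A c + resolv Aᴴ c * (S x)⁻¹ *
          (Complex.I • (P x * sigMat m₁ m₂ * (P x)ᴴ)) * (S x)⁻¹ * resolv A c) := by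
        simp only [conjTranspose_transfer h.isHermitian, Complex.star_def, Complex.conj_ofReal,
          Matrix.add_mul, Matrix.mul_add, Matrix.one_mul, Matrix.smul_mul, Matrix.mul_smul,
          Matrix.mul_assoc]
    _ = (P x)ᴴ * resolv Aᴴ c * (S x)⁻¹ := by rw [hnode, add_sub_cancel, Matrix.mul_assoc]

end SymmetricNode

section Evolution

variable {m₁ m₂ p n r : ℕ} {A : Matrix (Fin n) (Fin n) ℂ} {c : Fin r → ℝ}
  {β : Fin r → ℝ → Matrix (Fin p) (Fin m₁ ⊕ Fin m₂) ℂ}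
  {P : ℝ → Matrix (Fin n) (Fin m₁ ⊕ Fin m₂) ℂ} {S : ℝ → Matrix (Fin n) (Fin n) ℂ}
  {I : Set ℝ} {x : ℝ}

theorem conjTranspose_ham (k : Fin r) : (ham β k x)ᴴ = ham β k x :=
  Matrix.isHermitian_conjTranspose_mul_self (β k x)

theorem conjTranspose_rhsS : (rhsS A c β P x)ᴴ = rhsS A c β P x := by
  simp [rhsS, Matrix.conjTranspose_mul, Matrix.conjTranspose_sum, conjTranspose_sigMat,
    conjTranspose_ham, conjTranspose_resolv, Matrix.mul_assoc]

theorem conjTranspose_rhsPi : (rhsPi A c β P x)ᴴ =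
    Complex.I • ∑ k, ham β k x * sigMat m₁ m₂ * (P x)ᴴ * resolv Aᴴ (c k) := by
  simp [rhsPi, Matrix.conjTranspose_mul, Matrix.conjTranspose_sum, conjTranspose_sigMat,
    conjTranspose_ham, conjTranspose_resolv, Matrix.mul_assoc]

theorem sylvester_rhsS (hA : ∀ k, (c k : ℂ) ∉ spectrum ℂ A) :
    A * rhsS A c β P x - rhsS A c β P x * Aᴴ =
      Complex.I • (rhsPi A c β P x * sigMat m₁ m₂ * (P x)ᴴ +
        P x * sigMat m₁ m₂ * (rhsPi A c β P x)ᴴ) := by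
  set M : Fin r → Matrix (Fin n) (Fin n) ℂ :=
    fun k => P x * sigMat m₁ m₂ * ham β k x * sigMat m₁ m₂ * (P x)ᴴ with hM
  have hS : rhsS A c β P x = -∑ k, resolv A (c k) * M k * resolv Aᴴ (c k) := by
    simp only [rhsS, hM, Matrix.mul_assoc]
  have hP : rhsPi A c β P x * sigMat m₁ m₂ * (P x)ᴴ =
      -(Complex.I • ∑ k, resolv A (c k) * M k) := by
    simp only [rhsPi, hM, Matrix.neg_mul, Matrix.smul_mul, Matrix.sum_mul, Matrix.mul_assoc]
  have hP' : P x * sigMat m₁ m₂ * (rhsPi A c β P x)ᴴ =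
      Complex.I • ∑ k, M k * resolv Aᴴ (c k) := by
    simp only [conjTranspose_rhsPi, hM, Matrix.mul_smul, Matrix.mul_sum, Matrix.mul_assoc]
  calc A * rhsS A c β P x - rhsS A c β P x * Aᴴ
      = -∑ k, (A * (resolv A (c k) * M k * resolv Aᴴ (c k)) -
          resolv A (c k) * M k * resolv Aᴴ (c k) * Aᴴ) := by
        rw [hS, Finset.sum_sub_distrib, Matrix.mul_neg, Matrix.neg_mul, Matrix.mul_sum,
          Matrix.sum_mul]
        abel
    _ = -∑ k, (M k * resolv Aᴴ (c k) - resolv A (c k) * M k) := by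
        simp only [sylvester_resolv_mul_resolv (hA _)
          (ofReal_notMem_spectrum_conjTranspose (hA _))]
    _ = _ := by
        rw [hP, hP', Finset.sum_sub_distrib, smul_add, smul_neg, smul_smul, smul_smul,
          Complex.I_mul_I]
        module

theorem IsSymmetricSNode.of_solvesODEOn {x₀ : ℝ} (h : IsSymmetricSNode A (S x₀) (P x₀))
    (hI : I.OrdConnected) (hx₀ : x₀ ∈ I) (hA : ∀ k, (c k : ℂ) ∉ spectrum ℂ A)
    (hP : SolvesODEOn P (rhsPi A c β P) I) (hS : SolvesODEOn S (rhsS A c β P) I) (hx : x ∈ I) :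
    IsSymmetricSNode A (S x) (P x) := by
  have hSstar : SolvesODEOn (fun t => (S t)ᴴ) (rhsS A c β P) I :=
    ⟨hS.1.conjTranspose, hS.2.mono fun t ht htI => by
      simpa only [conjTranspose_rhsS] using (ht htI).conjTranspose⟩
  have hleft : SolvesODEOn (fun t => A * S t - S t * Aᴴ)
      (fun t => A * rhsS A c β P t - rhsS A c β P t * Aᴴ) I :=
    ⟨((LocallyAbsContOn.const A).mul hS.1).sub (hS.1.mul (.const Aᴴ)),
      hS.2.mono fun t ht htI => ((ht htI).const_mul A).sub ((ht htI).mul_const Aᴴ)⟩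
  have hright : SolvesODEOn (fun t => Complex.I • (P t * sigMat m₁ m₂ * (P t)ᴴ))
      (fun t => A * rhsS A c β P t - rhsS A c β P t * Aᴴ) I :=
    ⟨((hP.1.mul (.const (sigMat m₁ m₂))).mul hP.1.conjTranspose).const_smul Complex.I,
      hP.2.mono fun t ht htI => by
        simp only [sylvester_rhsS hA]
        exact (((ht htI).mul_const (sigMat m₁ m₂)).mul (ht htI).conjTranspose).const_smul Complex.I⟩
  exact ⟨hSstar.eqOn hI hS hx₀ h.isHermitian hx, hleft.eqOn hI hright hx₀ h.identity hx⟩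

theorem ham_transBeta (k : Fin r) : ham (transBeta A c β P S) k x =
    sigMat m₁ m₂ * transfer A P S x (c k) * sigMat m₁ m₂ * ham β k x * sigMat m₁ m₂ *
      (transfer A P S x (c k))ᴴ * sigMat m₁ m₂ := by
  simp only [ham, transBeta, Matrix.conjTranspose_mul, Matrix.conjTranspose_conjTranspose,
    conjTranspose_sigMat, Matrix.mul_assoc]

theorem IsSymmetricSNode.sigMat_mul_ham_transBeta_mul (h : IsSymmetricSNode A (S x) (P x))
    {k : Fin r} (hc : (c k : ℂ) ∉ spectrum ℂ A) (hSx : IsUnit (S x)) :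
    sigMat m₁ m₂ * ham (transBeta A c β P S) k x *
        (sigMat m₁ m₂ * (P x)ᴴ * (S x)⁻¹ * resolv A (c k)) =
      transfer A P S x (c k) * sigMat m₁ m₂ * ham β k x * sigMat m₁ m₂ *
        ((P x)ᴴ * resolv Aᴴ (c k) * (S x)⁻¹) := by
  have hj (M : Matrix (Fin m₁ ⊕ Fin m₂) (Fin n) ℂ) : sigMat m₁ m₂ * (sigMat m₁ m₂ * M) = M := by
    rw [← Matrix.mul_assoc, sigMat_mul_self, Matrix.one_mul]
  rw [← h.conjTranspose_transfer_mul hc hSx, ham_transBeta]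
  simp only [Matrix.mul_assoc, hj]

theorem IsSymmetricSNode.hasMatDerivWithinAt_sigMat_mul_conjTranspose_mul_inv
    (h : IsSymmetricSNode A (S x) (P x)) (hA : ∀ k, (c k : ℂ) ∉ spectrum ℂ A)
    (hSx : IsUnit (S x)) (hP : HasMatDerivWithinAt P (rhsPi A c β P x) I x)
    (hS : HasMatDerivWithinAt S (rhsS A c β P x) I x) :
    HasMatDerivWithinAt (fun t => sigMat m₁ m₂ * (P t)ᴴ * (S t)⁻¹)
      (Complex.I • ∑ k, sigMat m₁ m₂ * ham (transBeta A c β P S) k x *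
        (sigMat m₁ m₂ * (P x)ᴴ * (S x)⁻¹ * resolv A (c k))) I x := by
  convert (hP.conjTranspose.const_mul (sigMat m₁ m₂)).mul (hS.inv hSx) using 1
  simp only [h.sigMat_mul_ham_transBeta_mul (hA _) hSx, conjTranspose_rhsPi, rhsS, Matrix.mul_neg,
    Matrix.neg_mul, neg_neg, Matrix.mul_sum, Matrix.sum_mul, Matrix.smul_mul, Matrix.mul_smul,
    Finset.smul_sum, ← Finset.sum_add_distrib]
  refine Finset.sum_congr rfl fun k _ => ?_
  simp only [transfer, Matrix.sub_mul, Matrix.one_mul, Matrix.smul_mul, smul_sub, smul_smul,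
    Complex.I_mul_I, neg_smul, one_smul, sub_neg_eq_add, Matrix.mul_assoc]

open scoped Matrix.Norms.Operator in
theorem hasMatDerivWithinAt_psiTilde_update (ζ : Fin r → ℂ) (k : Fin r) :
    HasMatDerivWithinAt (fun s : ℂ => psiTilde A c P S x (Function.update ζ k s))
      (sigMat m₁ m₂ * (P x)ᴴ * (S x)⁻¹ *
        (resolv A (c k) * NormedSpace.exp (∑ l, ζ l • resolv A (c l)))) Set.univ (ζ k) :=
  (hasMatDerivWithinAt_iff.2 (hasDerivAt_exp_sum_update_smul
    (fun _ => resolv_commute A _ _) ζ).hasDerivWithinAt).const_mul _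

theorem IsSymmetricSNode.dynSystemAt_psiTilde (h : IsSymmetricSNode A (S x) (P x))
    (hA : ∀ k, (c k : ℂ) ∉ spectrum ℂ A) (hSx : IsUnit (S x))
    (hP : HasMatDerivWithinAt P (rhsPi A c β P x) I x)
    (hS : HasMatDerivWithinAt S (rhsS A c β P x) I x) :
    DynSystemAt (ham (transBeta A c β P S)) (psiTilde A c P S) I x := by
  refine fun ζ => ⟨_, hasMatDerivWithinAt_psiTilde_update ζ, ?_⟩
  simpa only [psiTilde, Matrix.smul_mul, Matrix.sum_mul, Matrix.mul_assoc] using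
    (h.hasMatDerivWithinAt_sigMat_mul_conjTranspose_mul_inv hA hSx hP hS).mul_const
      (NormedSpace.exp (∑ l, ζ l • resolv A (c l)))

theorem locallyAbsContOn_psiTilde {D : Set ℝ} (hP : LocallyAbsContOn P D)
    (hS : LocallyAbsContOn S D) (hu : ∀ x ∈ D, IsUnit (S x)) (ζ : Fin r → ℂ) :
    LocallyAbsContOn (fun x => psiTilde A c P S x ζ) D :=
  (((LocallyAbsContOn.const _).mul hP.conjTranspose).mul (hS.inv hu)).mul (.const _)

end Evolution

end GBDT

theorem theorem4p1_general {m₁ m₂ p n r : ℕ} {I : Set ℝ} (hI : I.OrdConnected) {x₀ : ℝ}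
    (hx₀ : x₀ ∈ I) {c : Fin r → ℝ} {β : Fin r → ℝ → Matrix (Fin p) (Fin m₁ ⊕ Fin m₂) ℂ}
    {A : Matrix (Fin n) (Fin n) ℂ} (hA : ∀ k, (c k : ℂ) ∉ spectrum ℂ A)
    {P : ℝ → Matrix (Fin n) (Fin m₁ ⊕ Fin m₂) ℂ} {S : ℝ → Matrix (Fin n) (Fin n) ℂ}
    (hnode : GBDT.IsSymmetricSNode A (S x₀) (P x₀))
    (hP : GBDT.SolvesODEOn P (GBDT.rhsPi A c β P) I)
    (hS : GBDT.SolvesODEOn S (GBDT.rhsS A c β P) I) :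
    (∀ ζ : Fin r → ℂ, GBDT.LocallyAbsContOn (fun x => GBDT.psiTilde A c P S x ζ)
        {x | x ∈ I ∧ IsUnit (S x)}) ∧
    (∀ᵐ x : ℝ, x ∈ I → IsUnit (S x) →
      GBDT.DynSystemAt (GBDT.ham (GBDT.transBeta A c β P S)) (GBDT.psiTilde A c P S) I x) ∧
    (∀ x ∈ I, IsUnit (S x) →
      GBDT.HasMatDerivWithinAt P (GBDT.rhsPi A c β P x) I x →
      GBDT.HasMatDerivWithinAt S (GBDT.rhsS A c β P x) I x →
      GBDT.DynSystemAt (GBDT.ham (GBDT.transBeta A c β P S)) (GBDT.psiTilde A c P S) I x) := by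
  have hdyn (x : ℝ) (hx : x ∈ I) (hSx : IsUnit (S x))
      (hP' : GBDT.HasMatDerivWithinAt P (GBDT.rhsPi A c β P x) I x)
      (hS' : GBDT.HasMatDerivWithinAt S (GBDT.rhsS A c β P x) I x) :
      GBDT.DynSystemAt (GBDT.ham (GBDT.transBeta A c β P S)) (GBDT.psiTilde A c P S) I x :=
    (hnode.of_solvesODEOn hI hx₀ hA hP hS hx).dynSystemAt_psiTilde hA hSx hP' hS'
  refine ⟨GBDT.locallyAbsContOn_psiTilde (hP.1.mono fun _ hx => hx.1)
    (hS.1.mono fun _ hx => hx.1) fun _ hx => hx.2, ?_, hdyn⟩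
  filter_upwards [hP.2, hS.2] with x hP' hS' hx hSx
  exact hdyn x hx hSx (hP' hx) (hS' hx)

theorem theorem4p1 {m₁ m₂ p n r : ℕ} (hm : 0 < m₁ + m₂) (hp : p ≤ m₁ + m₂) (hn : 0 < n)
    (I : Set ℝ) (hI : I.OrdConnected) (h0 : (0 : ℝ) ∈ I)
    (c : Fin r → ℝ) (β : Fin r → ℝ → Matrix (Fin p) (Fin m₁ ⊕ Fin m₂) ℂ)
    (hH : ∀ k i j, LocallyIntegrableOn (fun x => GBDT.ham β k x i j) I volume)
    (A : Matrix (Fin n) (Fin n) ℂ) (hA : ∀ k, (c k : ℂ) ∉ spectrum ℂ A)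
    (P : ℝ → Matrix (Fin n) (Fin m₁ ⊕ Fin m₂) ℂ) (S : ℝ → Matrix (Fin n) (Fin n) ℂ)
    (hnode : A * S 0 - S 0 * Aᴴ = Complex.I • (P 0 * GBDT.sigMat m₁ m₂ * (P 0)ᴴ))
    (hS0 : S 0 = (S 0)ᴴ)
    (hP : GBDT.SolvesODEOn P (GBDT.rhsPi A c β P) I)
    (hS : GBDT.SolvesODEOn S (GBDT.rhsS A c β P) I) :
    (∀ ζ : Fin r → ℂ, GBDT.LocallyAbsContOn (fun x => GBDT.psiTilde A c P S x ζ)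
        {x | x ∈ I ∧ IsUnit (S x)}) ∧
    (∀ᵐ x : ℝ, x ∈ I → IsUnit (S x) →
      GBDT.DynSystemAt (GBDT.ham (GBDT.transBeta A c β P S)) (GBDT.psiTilde A c P S) I x) ∧
    (∀ x ∈ I, IsUnit (S x) →
      GBDT.HasMatDerivWithinAt P (GBDT.rhsPi A c β P x) I x →
      GBDT.HasMatDerivWithinAt S (GBDT.rhsS A c β P x) I x →
      GBDT.DynSystemAt (GBDT.ham (GBDT.transBeta A c β P S)) (GBDT.psiTilde A c P S) I x) :=
  theorem4p1_general hI h0 hA ⟨hS0.symm, hnode⟩ hP hS
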